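/- For every real $h>0$ and every real $B$ there is a constant $C_{h,B}\in\mathbb{N}$ such that every convex polyhedron $P\subset\mathbb{R}^3$ (the convex hull of finitely many points, with non-empty interior) whose Melzak ratio $m(P)=e(P)^3/v(P)$ is less than $B$, where $e(P)$ is the sum of the lengths of the edges of $P$ and $v(P)$ is its volume, has at most $C_{h,B}$ quadrilateral faces whose protruding wedge is good and, after normalization, has height greater than $h$. Here, for a face $F$ of $P$, let $P^*_F$ be the intersection of the closed half-spaces that contain $P$ and are bounded by the planes of the faces of $P$ other than $F$. The protruding wedge at $F$ is the closure of $P^*_F\setminus P$, and $F$ is its base. The wedge is good if its dihedral angles along all edges of its base are acute. It is normalized by rescaling it so that the longest edge of its base has length $1$. Its height is the greatest distance of its points from the plane of its base. -/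

import Mathlib

open scoped ENNReal

noncomputable section

/-- Euclidean three-space. -/
abbrev Space3 : Type := EuclideanSpace ℝ (Fin 3)

/-- A convex polyhedron (with positive volume): the convex hull of finitely many points of
three-space, with non-empty interior. -/
def IsConvexPolyhedron (P : Set Space3) : Prop :=
  (∃ s : Set Space3, s.Finite ∧ P = convexHull ℝ s) ∧ (interior P).Nonempty

/-- `e` is an edge of `P`: a one-dimensional exposed face. -/
def IsEdge (P e : Set Space3) : Prop :=
  IsExposed ℝ P e ∧ Module.finrank ℝ (vectorSpan ℝ e) = 1

/-- `F` is a (two-dimensional) face of `P`. -/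
def IsFacet (P F : Set Space3) : Prop :=
  IsExposed ℝ P F ∧ Module.finrank ℝ (vectorSpan ℝ F) = 2

/-- A quadrilateral face: a two-dimensional face with exactly four vertices. -/
def IsQuadFacet (P F : Set Space3) : Prop :=
  IsFacet P F ∧ (F.extremePoints ℝ).encard = 4

/-- The total edge length `e(P)`. The length of an edge, which is a segment, is its diameter. -/
def edgeLength (P : Set Space3) : ℝ≥0∞ :=
  ∑' e : {e : Set Space3 // IsEdge P e}, Metric.ediam (e : Set Space3)

/-- The Melzak ratio `e(P) ^ 3 / v(P)`. -/
def melzakRatio (P : Set Space3) : ℝ≥0∞ :=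
  edgeLength P ^ 3 / MeasureTheory.volume P

/-- `u` is an outward unit normal of `P` at `F`: a unit vector such that `F` consists of the points
of `P` that are extremal in direction `u`. For a two-dimensional face `F` of a convex polyhedron
there is exactly one such `u`. -/
def IsOutwardNormal (P F : Set Space3) (u : Space3) : Prop :=
  ‖u‖ = 1 ∧ F = {x ∈ P | ∀ y ∈ P, inner ℝ u y ≤ inner ℝ u x}

/-- The closed half-space containing `P` whose boundary is the limiting plane of `P` at the
face `F`. -/
def limitingHalfspace (P F : Set Space3) : Set Space3 :=
  {x | ∀ u, IsOutwardNormal P F u → ∀ y ∈ F, inner ℝ u x ≤ inner ℝ u y}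

/-- The intersection of the limiting half-spaces of `P` at all faces other than `F`; it is the union
of `P` and the protruding wedge at `F`. -/
def removeFacet (P F : Set Space3) : Set Space3 :=
  ⋂ (G : Set Space3) (_ : IsFacet P G ∧ G ≠ F), limitingHalfspace P G

/-- The protruding wedge of `P` at the face `F` (its base). -/
def protrudingWedge (P F : Set Space3) : Set Space3 :=
  closure (removeFacet P F \ P)

/-- The dihedral angle, along the common edge, of a region that is locally the intersection of two
half-spaces with outward normals `u` and `v`. -/
def dihedralAngle (u v : Space3) : ℝ :=
  Real.pi - InnerProductGeometry.angle u v

/-- The protruding wedge at `F` is good: its dihedral angle along every edge `e` of its base `F` is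
acute. If `G` is the other face of `P` at `e`, and `u`, `v` are the outward normals of `P` at `F`
and `G`, then along `e` the wedge is bounded by the limiting planes of `F` and `G`; it lies on the
other side of the limiting plane of `F` than `P`, and on the same side of that of `G`, so the
outward normals of the wedge are `-u` and `v`. -/
def HasGoodWedge (P F : Set Space3) : Prop :=
  ∀ e, IsEdge P e → e ⊆ F → ∀ G, IsFacet P G → G ≠ F → e ⊆ G →
    ∀ u v, IsOutwardNormal P F u → IsOutwardNormal P G v →
      dihedralAngle (-u) v < Real.pi / 2

/-- The height of the protruding wedge at `F`: the greatest distance of its points from the plane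
of its base. -/
def wedgeHeight (P F : Set Space3) : ℝ≥0∞ :=
  ⨆ x ∈ protrudingWedge P F, Metric.infEDist x (affineSpan ℝ F : Set Space3)

/-- The length of the longest edge of the face `F`. -/
def longestEdge (P F : Set Space3) : ℝ≥0∞ :=
  ⨆ (e : Set Space3) (_ : IsEdge P e ∧ e ⊆ F), Metric.ediam e

/-- The height of the normalized protruding wedge at `F`, that is, of the wedge rescaled so that the
longest edge of its base has length `1`. -/
def normalizedWedgeHeight (P F : Set Space3) : ℝ≥0∞ :=
  wedgeHeight P F / longestEdge P F

end

/-!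
Let `F` be a quadrilateral face whose wedge is good and has normalized height greater than `h`, let
`u` be its outward unit normal, and let `g` be the outward unit normal of any other face `G`. Then
`‖u - g‖ ≥ h / (h + 5)` (`le_dist_normal`). Hence the outward normals of the faces to be counted are
separated points of the unit sphere, and compactness of the sphere bounds their number by a constant
that depends only on `h`, whatever the Melzak ratio.

For the bound, let `x` be a point of the wedge at height `H` above the plane of `F`, where `H` exceeds
`h` times the longest edge `L` of `F`, and let `y` be a point of `G`. The segment from `x` to `y` stays
in `removeFacet P F`, so it meets the plane of `F` in a point `z` of `F` (`mem_of_mem_removeFacet`).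
As `x` lies in the limiting half-space at `G`, `⟪g, x - z⟫ ≤ 0`, and so
`H = ⟪u, x - z⟫ ≤ ‖u - g‖ ‖x - z‖`. On the other hand, goodness of the wedge makes the foot `x'` of the
perpendicular from `x` to the plane of `F` a point of `F` (`foot_mem`), and the diameter of `F` is at
most `5 L` because `F` is a quadrilateral (`edist_le_longestEdge`). Therefore
`‖x - z‖ ≤ H + 5 L ≤ H + 5 H / h`, and the claim follows.

Most of the facts about polytopes that this needs come from one device: a supporting or separating
plane is tilted until it touches a further vertex (`exists_tilt`, `exists_separating_face`).
-/

/-! ### Supporting hyperplanes of finite point sets -/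

/-- Tilting a supporting hyperplane: if `a ≤ 0` on a finite set, and `f ≤ 0` wherever `a = 0`, then
some `f + τ a` is still nonpositive and vanishes at a new point, one where `a < 0`. -/
theorem exists_tilt {ι : Type*} (s : Finset ι) (a f : ι → ℝ) (ha : ∀ i ∈ s, a i ≤ 0)
    (hf : ∀ i ∈ s, a i = 0 → f i ≤ 0) (hne : ∃ i ∈ s, a i < 0) :
    ∃ τ : ℝ, (∀ i ∈ s, f i + τ * a i ≤ 0) ∧ ∃ i ∈ s, a i < 0 ∧ f i + τ * a i = 0 := by
  classical
  obtain ⟨j, hj, hja⟩ := hne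
  obtain ⟨i, hi, hmax⟩ := (s.filter fun i => a i < 0).exists_max_image (fun i => f i / -a i)
    ⟨j, by simp [hj, hja]⟩
  rw [Finset.mem_filter] at hi
  refine ⟨f i / -a i, fun p hp => ?_, i, hi.1, hi.2, ?_⟩
  · rcases (ha p hp).lt_or_eq with h | h
    · have := hmax p (by simp [hp, h])
      rw [div_le_iff₀ (by linarith)] at this
      linarith
    · simpa [h] using hf p hp h
  · have := hi.2.ne
    field_simp
    ring

/-- If `a` takes both signs and never vanishes, some `k + τ a` attains its maximum both at a point
where `a > 0` and at a point where `a < 0`. -/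
theorem exists_common_max {ι : Type*} (s : Finset ι) (a k : ι → ℝ) (h0 : ∀ i ∈ s, a i ≠ 0)
    (hpos : ∃ i ∈ s, 0 < a i) (hneg : ∃ i ∈ s, a i < 0) :
    ∃ τ M : ℝ, (∀ i ∈ s, k i + τ * a i ≤ M) ∧ (∃ i ∈ s, 0 < a i ∧ k i + τ * a i = M) ∧
      ∃ i ∈ s, a i < 0 ∧ k i + τ * a i = M := by
  classical
  obtain ⟨i₀, hi₀, hi₀'⟩ := hpos
  obtain ⟨j₀, hj₀, hj₀'⟩ := hneg
  -- `(k i * -a j + k j * a i) / (a i - a j)` is the height at which the segment from `(a i, k i)` to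
  -- `(a j, k j)` crosses the vertical axis; the highest crossing segment lies on a supporting line
  obtain ⟨⟨i, j⟩, hij, hmax⟩ :=
    ((s.filter fun i => 0 < a i) ×ˢ (s.filter fun i => a i < 0)).exists_max_image
      (fun x => (k x.1 * -a x.2 + k x.2 * a x.1) / (a x.1 - a x.2))
      ⟨(i₀, j₀), by simp [hi₀, hi₀', hj₀, hj₀']⟩
  simp only [Finset.mem_product, Finset.mem_filter] at hij hmax
  obtain ⟨⟨hi, hai⟩, hj, haj⟩ := hij
  have hd : 0 < a i - a j := by linarith
  have hd' := hd.ne'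
  set M := (k i * -a j + k j * a i) / (a i - a j) with hM
  have hMi : k i + (k j - k i) / (a i - a j) * a i = M := by rw [hM]; field_simp; ring
  have hMj : k j + (k j - k i) / (a i - a j) * a j = M := by rw [hM]; field_simp; ring
  set τ := (k j - k i) / (a i - a j)
  refine ⟨τ, M, fun p hp => ?_, ⟨i, hi, hai, hMi⟩, j, hj, haj, hMj⟩
  rcases (h0 p hp).lt_or_gt with h | h
  · have := hmax (i, p) ⟨⟨hi, hai⟩, hp, h⟩
    simp only at this
    rw [div_le_iff₀ (by linarith)] at this
    have hki : k i = M - τ * a i := by linarith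
    rw [hki] at this
    by_contra! hc
    nlinarith [mul_pos hai (sub_pos.2 hc)]
  · have := hmax (p, j) ⟨⟨hp, h⟩, hj, haj⟩
    simp only at this
    rw [div_le_iff₀ (by linarith)] at this
    have hkj : k j = M - τ * a j := by linarith
    rw [hkj] at this
    by_contra! hc
    nlinarith [mul_pos (neg_pos.2 haj) (sub_pos.2 hc)]

section
variable {E : Type*} [NormedAddCommGroup E] [InnerProductSpace ℝ E]

theorem inner_le_of_mem_convexHull {s : Set E} {g : E} {m : ℝ} (h : ∀ p ∈ s, inner ℝ g p ≤ m) :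
    ∀ p ∈ convexHull ℝ s, inner ℝ g p ≤ m :=
  fun _ hp => convexHull_min (t := {p | inner ℝ g p ≤ m}) h
    (convex_halfSpace_le (innerSL ℝ g).isLinear m) hp

theorem isExposed_setOf_inner_eq {P : Set E} {g : E} {m : ℝ} (h : ∀ p ∈ P, inner ℝ g p ≤ m) :
    IsExposed ℝ P {p ∈ P | inner ℝ g p = m} := by
  rintro ⟨q, hq, hqm⟩
  refine ⟨innerSL ℝ g, ?_⟩
  ext p
  simp only [Set.mem_ofPred_eq, innerSL_apply_apply]
  refine and_congr_right fun hp => ⟨fun hpm y hy => hpm ▸ h y hy, fun hp' => ?_⟩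
  exact le_antisymm (h p hp) (hqm ▸ hp' q hq)

theorem exists_orthogonal_inner_ne_zero [FiniteDimensional ℝ E] {K : Submodule ℝ E} {v : E}
    (hv : v ∉ K) : ∃ w ∈ Kᗮ, inner ℝ w v ≠ 0 := by
  by_contra! h
  exact hv (K.orthogonal_orthogonal ▸ (Submodule.mem_orthogonal _ _).2 h)

/-- A point outside the convex hull of a finite set is separated from it by a hyperplane that contains
a facet of the hull, in the sense that the points of the set on the hyperplane span a subspace of
codimension at most one. Among the separating hyperplanes, one that contains as many points of the
set as possible will do. -/
theorem exists_separating_face [FiniteDimensional ℝ E] {s : Set E} (hs : s.Finite) {x : E}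
    (hx : x ∉ convexHull ℝ s) :
    ∃ (g : E) (m : ℝ), (∀ p ∈ s, inner ℝ g p ≤ m) ∧ m < inner ℝ g x ∧
      Module.finrank ℝ (vectorSpan ℝ s) ≤
        Module.finrank ℝ (vectorSpan ℝ {p ∈ s | inner ℝ g p = m}) + 1 := by
  classical
  lift s to Finset E using hs
  let Q : Finset E → Prop := fun T => ∃ (g : E) (m : ℝ), (∀ p ∈ s, inner ℝ g p ≤ m) ∧
    m < inner ℝ g x ∧ ∀ p ∈ T, inner ℝ g p = m
  have hQ : Q ∅ := by
    obtain ⟨l, m, hl, hlx⟩ := geometric_hahn_banach_closed_point (convex_convexHull ℝ (s : Set E))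
      (s.finite_toSet.isClosed_convexHull ℝ) hx
    refine ⟨(InnerProductSpace.toDual ℝ E).symm l, m, fun p hp => ?_, ?_, by simp⟩
    · simpa using (hl p (subset_convexHull ℝ _ hp)).le
    · simpa using hlx
  obtain ⟨T, hT, hmax⟩ := (s.powerset.filter Q).exists_max_image Finset.card ⟨∅, by simp [hQ]⟩
  simp only [Finset.mem_filter, Finset.mem_powerset] at hT hmax
  obtain ⟨hTs, g, m, hgs, hgx, hgT⟩ := hT
  have hins : ∀ p ∈ s, Q (insert p T) → p ∈ T := by
    intro p hp hpQ
    by_contra hpT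
    have := hmax _ ⟨Finset.insert_subset hp hTs, hpQ⟩
    rw [Finset.card_insert_of_notMem hpT] at this
    omega
  have htight : ∀ p ∈ s, inner ℝ g p = m → p ∈ T := fun p hp hpm =>
    hins p hp ⟨g, m, hgs, hgx, by simpa [hpm] using hgT⟩
  refine ⟨g, m, hgs, hgx, ?_⟩
  have hTeq : {p ∈ (s : Set E) | inner ℝ g p = m} = T := by
    ext p
    exact ⟨fun h => htight p h.1 h.2, fun h => ⟨hTs h, hgT p h⟩⟩
  rw [hTeq]
  refine le_trans (Submodule.finrank_mono ?_) (finrank_vectorSpan_insert_le_set ℝ (T : Set E) x)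
  -- it suffices that `s` lies in the affine span of `T` and `x`; otherwise the hyperplane can be
  -- tilted about that span until it touches another point of `s`
  rw [← direction_affineSpan ℝ (s : Set E), ← direction_affineSpan ℝ (insert x (T : Set E))]
  refine AffineSubspace.direction_le (affineSpan_le.2 fun j hj => ?_)
  by_contra hj'
  have hjv : j - x ∉ vectorSpan ℝ (insert x (T : Set E)) := by
    intro h
    apply hj'
    have := AffineSubspace.vadd_mem_of_mem_direction
      (s := affineSpan ℝ (insert x (T : Set E))) (by rwa [direction_affineSpan])
      (mem_affineSpan ℝ (Set.mem_insert x _))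
    simpa using this
  obtain ⟨w, hwT, hwj⟩ : ∃ w : E, (∀ p ∈ T, inner ℝ w (p - x) = 0) ∧ 0 < inner ℝ w (j - x) := by
    obtain ⟨w, hw, hwj⟩ := exists_orthogonal_inner_ne_zero hjv
    have hw' : ∀ p ∈ T, inner ℝ w (p - x) = 0 := fun p hp => by
      rw [real_inner_comm]
      exact hw _ (vsub_mem_vectorSpan ℝ (Set.mem_insert_of_mem _ hp) (Set.mem_insert _ _))
    rcases hwj.lt_or_gt with h | h
    · exact ⟨-w, fun p hp => by simp [hw' p hp], by simpa using h⟩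
    · exact ⟨w, hw', h⟩
  obtain ⟨τ, hτ, i, hi, hai, hfi⟩ := exists_tilt s (fun p => inner ℝ g p - m)
    (fun p => inner ℝ w (p - x)) (fun p hp => by simpa using hgs p hp)
    (fun p hp h => (hwT p (htight p hp (by linarith))).le)
    ⟨j, hj, by
      refine lt_of_le_of_ne (by simpa using hgs j hj) fun h => hwj.ne' (hwT j ?_)
      exact htight j hj (by linarith)⟩
  -- since `τ > 0`, the tilted hyperplane still separates `x` from `s`
  have hτpos : 0 < τ := by
    have h1 := hτ j hj
    have h2 := hgs j hj
    by_contra! h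
    nlinarith [mul_nonneg_of_nonpos_of_nonpos h (sub_nonpos.2 h2)]
  refine hai.ne (sub_eq_zero.2 (hgT i (hins i hi ?_)))
  refine ⟨w + τ • g, inner ℝ w x + τ * m, fun p hp => ?_, ?_, fun p hp => ?_⟩
  · have := hτ p hp
    rw [inner_sub_right] at this
    rw [inner_add_left, real_inner_smul_left]
    linarith
  · rw [inner_add_left, real_inner_smul_left]
    nlinarith
  · rw [inner_add_left, real_inner_smul_left]
    rw [inner_sub_right] at hfi
    rcases Finset.mem_insert.1 hp with rfl | hp
    · linarith
    · have := hwT p hp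
      rw [inner_sub_right] at this
      rw [hgT p hp]
      linarith

end

/-! ### Faces and edges of polyhedra -/

/-- A set on which `k` nonzero orthogonal functionals are constant has dimension at most `3 - k`. -/
theorem finrank_vectorSpan_le_of_inner_eq {A : Set Space3} {k : ℕ} (v : Fin k → Space3)
    (hv : ∀ i, v i ≠ 0) (ho : Pairwise fun i j => inner ℝ (v i) (v j) = 0) (m : Fin k → ℝ)
    (hA : ∀ i, ∀ p ∈ A, inner ℝ (v i) p = m i) :
    Module.finrank ℝ (vectorSpan ℝ A) + k ≤ 3 := by
  have hle : Submodule.span ℝ (Set.range v) ≤ (vectorSpan ℝ A)ᗮ := by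
    rw [Submodule.span_le, Set.range_subset_iff]
    intro i
    rw [SetLike.mem_coe, Submodule.mem_orthogonal']
    intro d hd
    refine Submodule.span_induction (p := fun d _ => inner ℝ (v i) d = 0) ?_ ?_ ?_ ?_ hd
    · rintro _ ⟨p, hp, q, hq, rfl⟩
      simp [inner_sub_right, hA i p hp, hA i q hq]
    · simp
    · intro a b _ _ ha hb
      simp [inner_add_right, ha, hb]
    · intro a b _ hb
      simp [real_inner_smul_right, hb]
  have h1 := Submodule.finrank_mono hle
  rw [finrank_span_eq_card (linearIndependent_of_ne_zero_of_inner_eq_zero hv ho)] at h1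
  have h2 := (vectorSpan ℝ A).finrank_add_finrank_orthogonal
  simp only [Fintype.card_fin, finrank_euclideanSpace] at h1 h2
  omega

theorem finrank_vectorSpan_le_two {A : Set Space3} {g : Space3} (hg : g ≠ 0) {m : ℝ}
    (hA : ∀ p ∈ A, inner ℝ g p = m) : Module.finrank ℝ (vectorSpan ℝ A) ≤ 2 := by
  have := finrank_vectorSpan_le_of_inner_eq (A := A) ![g] (by simp [hg])
    (fun i j h => (h (Subsingleton.elim i j)).elim) ![m] (by simpa using hA)
  omega

theorem finrank_vectorSpan_le_one {A : Set Space3} {u w : Space3} (hu : u ≠ 0) (hw : w ≠ 0)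
    (huw : inner ℝ u w = 0) {c m : ℝ} (hAu : ∀ p ∈ A, inner ℝ u p = c)
    (hAw : ∀ p ∈ A, inner ℝ w p = m) : Module.finrank ℝ (vectorSpan ℝ A) ≤ 1 := by
  have := finrank_vectorSpan_le_of_inner_eq (A := A) ![u, w] (by simp [Fin.forall_fin_two, hu, hw])
    (by
      intro i j h
      fin_cases i <;> fin_cases j <;> simp_all [real_inner_comm]) ![c, m]
    (by simpa [Fin.forall_fin_two] using ⟨hAu, hAw⟩)
  omega

theorem nonempty_of_finrank_vectorSpan_pos {A : Set Space3}
    (h : 0 < Module.finrank ℝ (vectorSpan ℝ A)) : A.Nonempty := by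
  by_contra hA
  rw [Set.not_nonempty_iff_eq_empty] at hA
  rw [hA, vectorSpan_empty, finrank_bot] at h
  exact h.false

theorem finrank_vectorSpan_pos {A : Set Space3} {p q : Space3} (hp : p ∈ A) (hq : q ∈ A)
    (hpq : p ≠ q) : 0 < Module.finrank ℝ (vectorSpan ℝ A) := by
  rw [Module.finrank_pos_iff_exists_ne_zero]
  exact ⟨⟨p - q, vsub_mem_vectorSpan ℝ hp hq⟩, by simpa [sub_eq_zero] using hpq⟩

theorem finrank_vectorSpan_of_interior_nonempty {s : Set Space3}
    (h : (interior (convexHull ℝ s)).Nonempty) : Module.finrank ℝ (vectorSpan ℝ s) = 3 := by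
  rw [interior_convexHull_nonempty_iff_affineSpan_eq_top] at h
  rw [← direction_affineSpan, h, AffineSubspace.direction_top, finrank_top]
  exact finrank_euclideanSpace_fin

theorem exists_inner_lt {s : Set Space3} (h : (interior (convexHull ℝ s)).Nonempty) {g : Space3}
    (hg : g ≠ 0) {m : ℝ} (hs : ∀ p ∈ s, inner ℝ g p ≤ m) : ∃ p ∈ s, inner ℝ g p < m := by
  by_contra! hc
  have := finrank_vectorSpan_le_two hg fun p hp => (hs p hp).antisymm (hc p hp)
  rw [finrank_vectorSpan_of_interior_nonempty h] at this
  omega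

theorem isOutwardNormal_normalize {P : Set Space3} {g : Space3} (hg : g ≠ 0) {m : ℝ}
    (hP : ∀ p ∈ P, inner ℝ g p ≤ m) (hne : {p ∈ P | inner ℝ g p = m}.Nonempty) :
    IsOutwardNormal P {p ∈ P | inner ℝ g p = m} (‖g‖⁻¹ • g) := by
  have hg' : 0 < ‖g‖⁻¹ := by positivity
  refine ⟨by rw [norm_smul, norm_inv, norm_norm, inv_mul_cancel₀ (norm_ne_zero_iff.2 hg)], ?_⟩
  obtain ⟨q, hq, hqm⟩ := hne
  ext p
  simp only [Set.mem_ofPred_eq, real_inner_smul_left, mul_le_mul_iff_of_pos_left hg']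
  exact and_congr_right fun hp =>
    ⟨fun h y hy => h ▸ hP y hy, fun h => (hP p hp).antisymm (hqm ▸ h q hq)⟩

theorem IsFacet.exists_normal {P F : Set Space3} (hP : IsConvexPolyhedron P) (hF : IsFacet P F) :
    ∃ (u : Space3) (c : ℝ), IsOutwardNormal P F u ∧ (∀ p ∈ P, inner ℝ u p ≤ c) ∧
      F = {p ∈ P | inner ℝ u p = c} := by
  obtain ⟨⟨s, -, rfl⟩, hint⟩ := hP
  obtain ⟨hexp, hdim⟩ := hF
  obtain ⟨q, hq⟩ := nonempty_of_finrank_vectorSpan_pos (A := F) (by omega)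
  obtain ⟨l, hl⟩ := hexp ⟨q, hq⟩
  set g := (InnerProductSpace.toDual ℝ Space3).symm l with hg
  have hgl : ∀ p, inner ℝ g p = l p := fun p => by simp [hg]
  simp only [← hgl] at hl
  have hq' := hl ▸ hq
  have hle : ∀ p ∈ convexHull ℝ s, inner ℝ g p ≤ inner ℝ g q := hq'.2
  have hFeq : F = {p ∈ convexHull ℝ s | inner ℝ g p = inner ℝ g q} := by
    rw [hl]
    ext p
    exact and_congr_right fun hp => ⟨fun h => (hle p hp).antisymm (h q hq'.1), fun h y hy =>
      h ▸ hle y hy⟩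
  have hg0 : g ≠ 0 := by
    intro h0
    have : F = convexHull ℝ s := by rw [hFeq]; simp [h0]
    have h3 := finrank_vectorSpan_of_interior_nonempty hint
    rw [this, ← direction_affineSpan, affineSpan_convexHull, direction_affineSpan] at hdim
    omega
  have hn := isOutwardNormal_normalize hg0 hle ⟨q, hq'.1, rfl⟩
  rw [← hFeq] at hn
  have hpos : 0 < ‖g‖⁻¹ := by positivity
  refine ⟨_, ‖g‖⁻¹ * inner ℝ g q, hn, fun p hp => ?_, ?_⟩
  · rw [real_inner_smul_left]
    exact mul_le_mul_of_nonneg_left (hle p hp) hpos.le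
  · rw [hFeq]
    ext p
    simp [real_inner_smul_left, hg0]

theorem inner_le_of_mem_limitingHalfspace {P : Set Space3} {g : Space3} (hg : g ≠ 0) {m : ℝ}
    (hP : ∀ p ∈ P, inner ℝ g p ≤ m) (hne : {p ∈ P | inner ℝ g p = m}.Nonempty) {x : Space3}
    (hx : x ∈ limitingHalfspace P {p ∈ P | inner ℝ g p = m}) : inner ℝ g x ≤ m := by
  obtain ⟨q, hq⟩ := hne
  have := hx _ (isOutwardNormal_normalize hg hP ⟨q, hq⟩) q hq
  rw [real_inner_smul_left, real_inner_smul_left] at this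
  have := le_of_mul_le_mul_left this (by positivity)
  rwa [hq.2] at this

/-- The part of `removeFacet P F` on the inner side of the plane of `F` is contained in `P`, because a
polyhedron is the intersection of its limiting half-spaces. -/
theorem mem_of_mem_removeFacet {P F : Set Space3} (hP : IsConvexPolyhedron P) (hF : IsFacet P F)
    {u : Space3} {c : ℝ} (hu : ‖u‖ = 1) (hle : ∀ p ∈ P, inner ℝ u p ≤ c)
    (hFeq : F = {p ∈ P | inner ℝ u p = c}) {x : Space3} (hx : x ∈ removeFacet P F)
    (hxc : inner ℝ u x ≤ c) : x ∈ P := by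
  obtain ⟨⟨s, hs, rfl⟩, hint⟩ := hP
  by_contra hxP
  obtain ⟨g, m, hgs, hgx, hdim⟩ := exists_separating_face hs hxP
  rw [finrank_vectorSpan_of_interior_nonempty hint] at hdim
  have hu0 : u ≠ 0 := by rintro rfl; simp at hu
  have hg0 : g ≠ 0 := by
    rintro rfl
    obtain ⟨p, hp⟩ := nonempty_of_finrank_vectorSpan_pos
      (A := {p ∈ s | inner ℝ (0 : Space3) p = m}) (by omega)
    simp at hgx hp
    linarith
  have hgP := inner_le_of_mem_convexHull hgs
  set G := {p ∈ convexHull ℝ s | inner ℝ g p = m} with hG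
  have hsub : {p ∈ s | inner ℝ g p = m} ⊆ G := fun p hp => ⟨subset_convexHull ℝ s hp.1, hp.2⟩
  have hG2 : 2 ≤ Module.finrank ℝ (vectorSpan ℝ G) := by
    have := Submodule.finrank_mono (vectorSpan_mono ℝ hsub)
    omega
  have hGfacet : IsFacet (convexHull ℝ s) G :=
    ⟨isExposed_setOf_inner_eq hgP,
      (finrank_vectorSpan_le_two hg0 fun p hp => hp.2).antisymm hG2⟩
  have hGne : G.Nonempty := nonempty_of_finrank_vectorSpan_pos (by omega)
  by_cases hGF : G = F
  · -- `G` and `F` span the same plane, so that `g` is a multiple of `u`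
    have hw : g - inner ℝ u g • u = 0 := by
      by_contra hw
      have := finrank_vectorSpan_le_one (A := G) (m := m - inner ℝ u g * c) hu0 hw
        (by rw [inner_sub_right, real_inner_smul_right, real_inner_self_eq_norm_sq, hu]; ring)
        (fun p hp => by rw [hGF, hFeq] at hp; exact hp.2)
        (fun p hp => by
          have h1 := hp.2
          rw [hGF, hFeq] at hp
          rw [inner_sub_left, real_inner_smul_left, hp.2, h1])
      omega
    have hgu : ∀ p, inner ℝ g p = inner ℝ u g * inner ℝ u p := fun p => by
      rw [← real_inner_smul_left, ← sub_eq_zero.1 hw]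
    obtain ⟨q, hq⟩ := hGne
    have hqu : inner ℝ u q = c := by
      have := hGF ▸ hq
      rw [hFeq] at this
      exact this.2
    have hm : m = inner ℝ u g * c := by rw [← hq.2, hgu, hqu]
    obtain ⟨p, hp, hpc⟩ := exists_inner_lt hint hu0 fun p hp => hle p (subset_convexHull ℝ s hp)
    have h1 := hgs p hp
    rw [hgu, hm] at h1
    rw [hgu, hm] at hgx
    -- a negative multiple is excluded by `p`, a nonnegative one by `x`
    rcases lt_or_ge (inner ℝ u g) 0 with h | h <;> nlinarith
  · exact hgx.not_ge (inner_le_of_mem_limitingHalfspace hg0 hgP hGne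
      (Set.mem_iInter₂.1 hx G ⟨hGfacet, hGF⟩))

/-- An edge of the polygon `F` is an edge of `P`; the point is that a face of a face of a polytope is
exposed in the polytope. -/
theorem isEdge_setOf_inner_eq {P F : Set Space3} (hP : IsConvexPolyhedron P)
    {u : Space3} {c : ℝ} (hu : u ≠ 0) (hle : ∀ p ∈ P, inner ℝ u p ≤ c)
    (hFeq : F = {p ∈ P | inner ℝ u p = c}) {w : Space3} {m : ℝ} (hw : w ≠ 0)
    (huw : inner ℝ u w = 0) (hwF : ∀ p ∈ F, inner ℝ w p ≤ m)
    (hpos : 0 < Module.finrank ℝ (vectorSpan ℝ {p ∈ F | inner ℝ w p = m})) :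
    IsEdge P {p ∈ F | inner ℝ w p = m} := by
  obtain ⟨⟨s, hs, rfl⟩, hint⟩ := hP
  lift s to Finset Space3 using hs
  refine ⟨?_, (finrank_vectorSpan_le_one hu hw huw (c := c) (m := m) (fun p hp => ?_)
    fun p hp => hp.2).antisymm hpos⟩
  swap
  · have := hFeq ▸ hp.1
    exact this.2
  obtain ⟨τ, hτ, -⟩ := exists_tilt s (fun p => inner ℝ u p - c) (fun p => inner ℝ w p - m)
    (fun p hp => by simpa using hle p (subset_convexHull ℝ _ hp))
    (fun p hp h => by
      have : p ∈ F := hFeq ▸ ⟨subset_convexHull ℝ _ hp, by linarith⟩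
      simpa using hwF p this)
    (by
      obtain ⟨p, hp, hpc⟩ := exists_inner_lt hint hu fun p hp => hle p (subset_convexHull ℝ _ hp)
      exact ⟨p, hp, by simpa using hpc⟩)
  have hconv : ∀ p ∈ convexHull ℝ (s : Set Space3), inner ℝ (w + τ • u) p ≤ m + τ * c :=
    inner_le_of_mem_convexHull fun p hp => by
      have := hτ p hp
      rw [inner_add_left, real_inner_smul_left]
      linarith
  -- tilting strictly beyond `τ` leaves only the points of `F` on the supporting plane
  have key : {p ∈ F | inner ℝ w p = m} = {p ∈ convexHull ℝ (s : Set Space3) |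
      inner ℝ (w + (τ + 1) • u) p = m + (τ + 1) * c} := by
    rw [hFeq]
    ext p
    simp only [Set.mem_ofPred_eq, inner_add_left, real_inner_smul_left, and_assoc]
    refine and_congr_right fun hp => ⟨fun h => by rw [h.1, h.2], fun h => ?_⟩
    have h1 := hconv p hp
    have h2 := hle p hp
    rw [inner_add_left, real_inner_smul_left] at h1
    have h3 : inner ℝ u p = c := by linarith
    rw [h3] at h
    exact ⟨h3, by linarith⟩
  rw [key]
  refine isExposed_setOf_inner_eq fun p hp => ?_
  have h1 := hconv p hp
  have h2 := hle p hp
  rw [inner_add_left, real_inner_smul_left] at h1 ⊢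
  linarith

/-! ### Good wedges project into their bases -/

/-- The orthogonal projection of a point of a good wedge to the plane of the base lies in the base.
If not, it is separated from `F` by an edge `e` of `F`. The acute angle at `e` means that the outward
normal of the other face at `e` has a positive component along the outward normal of `F`, so the
limiting half-space of that face, restricted to the outer side of the plane of `F`, projects to the
inner side of `e`. -/
theorem foot_mem {P F : Set Space3} (hP : IsConvexPolyhedron P) (hF : IsFacet P F)
    (hgood : HasGoodWedge P F) {V : Set Space3} (hV : V.Finite) (hFV : F = convexHull ℝ V)
    {u : Space3} {c : ℝ} (hu : IsOutwardNormal P F u) (hle : ∀ p ∈ P, inner ℝ u p ≤ c)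
    (hFeq : F = {p ∈ P | inner ℝ u p = c}) {x : Space3} (hx : x ∈ removeFacet P F)
    (hxc : c ≤ inner ℝ u x) : x - (inner ℝ u x - c) • u ∈ F := by
  by_contra hxF
  have huu : inner ℝ u u = (1 : ℝ) := by rw [real_inner_self_eq_norm_sq, hu.1]; norm_num
  have hu0 : u ≠ 0 := by rintro rfl; simp at huu
  have hVF : V ⊆ F := hFV ▸ subset_convexHull ℝ V
  have hFc : ∀ p ∈ F, inner ℝ u p = c := fun p hp => by rw [hFeq] at hp; exact hp.2
  have hFP : F ⊆ P := fun p hp => by rw [hFeq] at hp; exact hp.1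
  obtain ⟨g, m', hgV, hgx, hdim⟩ := exists_separating_face hV (hFV ▸ hxF)
  have hV2 : Module.finrank ℝ (vectorSpan ℝ V) = 2 := by
    rw [← hF.2, hFV, ← direction_affineSpan ℝ (convexHull ℝ V), affineSpan_convexHull,
      direction_affineSpan]
  rw [hV2] at hdim
  -- the component of `g` in the plane of `F`
  obtain ⟨w, m, huw, hwF, hwx, hwg⟩ : ∃ (w : Space3) (m : ℝ), inner ℝ u w = 0 ∧
      (∀ p ∈ F, inner ℝ w p ≤ m) ∧ m < inner ℝ w x ∧
      {p ∈ V | inner ℝ g p = m'} ⊆ {p ∈ F | inner ℝ w p = m} := by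
    have hwp : ∀ p, inner ℝ (g - inner ℝ u g • u) p = inner ℝ g p - inner ℝ u g * inner ℝ u p :=
      fun p => by rw [inner_sub_left, real_inner_smul_left]
    refine ⟨g - inner ℝ u g • u, m' - inner ℝ u g * c, ?_, fun p hp => ?_, ?_, fun p hp => ?_⟩
    · rw [inner_sub_right, real_inner_smul_right, huu]; ring
    · rw [hwp, hFc p hp]
      linarith [inner_le_of_mem_convexHull hgV p (hFV ▸ hp)]
    · rw [hwp]
      rw [inner_sub_right, real_inner_smul_right, real_inner_comm u g] at hgx
      linarith
    · refine ⟨hVF hp.1, ?_⟩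
      rw [hwp, hFc p (hVF hp.1), hp.2]
  set e := {p ∈ F | inner ℝ w p = m} with he
  have he1 : 0 < Module.finrank ℝ (vectorSpan ℝ e) := by
    have := Submodule.finrank_mono (vectorSpan_mono ℝ hwg)
    omega
  obtain ⟨q, hq⟩ := nonempty_of_finrank_vectorSpan_pos he1
  have hw0 : w ≠ 0 := by
    rintro rfl
    have := hwF q hq.1
    simp at this hwx
    linarith
  have hedge : IsEdge P e := isEdge_setOf_inner_eq hP hu0 hle hFeq hw0 huw hwF he1
  obtain ⟨⟨s, hs, rfl⟩, hint⟩ := hP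
  lift s to Finset Space3 using hs
  -- the plane of the other face at `e` is found by tilting the plane of `F` about `e`
  obtain ⟨τ, hτ, i, hi, hai, hfi⟩ := exists_tilt s (fun p => inner ℝ u p - c)
    (fun p => inner ℝ w p - m)
    (fun p hp => by simpa using hle p (subset_convexHull ℝ _ hp))
    (fun p hp h => by
      have : p ∈ F := hFeq ▸ ⟨subset_convexHull ℝ _ hp, by linarith⟩
      simpa using hwF p this)
    (by
      obtain ⟨p, hp, hpc⟩ := exists_inner_lt hint hu0 fun p hp => hle p (subset_convexHull ℝ _ hp)
      exact ⟨p, hp, by simpa using hpc⟩)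
  have hgp : ∀ p, inner ℝ (w + τ • u) p = inner ℝ w p + τ * inner ℝ u p := fun p => by
    rw [inner_add_left, real_inner_smul_left]
  have hgP : ∀ p ∈ convexHull ℝ (s : Set Space3), inner ℝ (w + τ • u) p ≤ m + τ * c :=
    inner_le_of_mem_convexHull fun p hp => by
      have := hτ p hp
      rw [hgp]
      linarith
  have hg0 : w + τ • u ≠ 0 := by
    intro h
    have h1 : inner ℝ w (w + τ • u) = (0 : ℝ) := by rw [h, inner_zero_right]
    rw [inner_add_right, real_inner_smul_right, real_inner_comm u w, huw, mul_zero, add_zero] at h1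
    exact hw0 (inner_self_eq_zero.1 h1)
  set G := {p ∈ convexHull ℝ (s : Set Space3) | inner ℝ (w + τ • u) p = m + τ * c} with hG
  have heG : e ⊆ G := fun p hp => ⟨hFP hp.1, by rw [hgp, hp.2, hFc p hp.1]⟩
  have hiG : i ∈ G := ⟨subset_convexHull ℝ _ hi, by rw [hgp]; linarith⟩
  have hlt : vectorSpan ℝ e < vectorSpan ℝ G := by
    refine lt_of_le_of_ne (vectorSpan_mono ℝ heG) fun heq => ?_
    have hmem : i - q ∈ vectorSpan ℝ e := heq ▸ vsub_mem_vectorSpan ℝ hiG (heG hq)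
    have : vectorSpan ℝ e ≤ (innerSL ℝ u).toLinearMap.ker := by
      refine Submodule.span_le.2 ?_
      rintro _ ⟨p, hp, r, hr, rfl⟩
      simp [inner_sub_right, hFc p hp.1, hFc r hr.1]
    have := this hmem
    simp [inner_sub_right, hFc q hq.1] at this
    linarith
  have hGfacet : IsFacet (convexHull ℝ (s : Set Space3)) G := by
    refine ⟨isExposed_setOf_inner_eq hgP,
      (finrank_vectorSpan_le_two hg0 fun p hp => hp.2).antisymm ?_⟩
    have := Submodule.finrank_lt_finrank_of_lt hlt
    omega
  have hGF : G ≠ F := fun h => by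
    have := hFc i (h ▸ hiG)
    linarith
  have hangle := hgood e hedge (fun p hp => hp.1) G hGfacet hGF heG u _ hu
    (isOutwardNormal_normalize hg0 hgP ⟨i, hiG⟩)
  -- `τ` is the inner product of `w + τ • u` with `u`, so this is where goodness enters
  have hτpos : 0 < τ := by
    by_contra! h
    rw [dihedralAngle, InnerProductGeometry.angle] at hangle
    have : Real.arccos (inner ℝ (-u) (‖w + τ • u‖⁻¹ • (w + τ • u)) /
        (‖-u‖ * ‖‖w + τ • u‖⁻¹ • (w + τ • u)‖)) ≤ Real.pi / 2 := by
      refine Real.arccos_le_pi_div_two.2 (div_nonneg ?_ (by positivity))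
      rw [real_inner_smul_right, inner_neg_left, inner_add_right, real_inner_smul_right, huw, huu]
      exact mul_nonneg (by positivity) (by linarith)
    linarith
  have hxG := inner_le_of_mem_limitingHalfspace hg0 hgP ⟨i, hiG⟩
    (Set.mem_iInter₂.1 hx G ⟨hGfacet, hGF⟩)
  rw [hgp] at hxG
  nlinarith

/-! ### The diameter of a quadrilateral face -/

theorem IsFacet.eq_convexHull_extremePoints {P F : Set Space3} (hP : IsConvexPolyhedron P)
    (hF : IsFacet P F) (hfin : (F.extremePoints ℝ).Finite) :
    F = convexHull ℝ (F.extremePoints ℝ) := by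
  obtain ⟨⟨s, hs, rfl⟩, -⟩ := hP
  have h := closure_convexHull_extremePoints (hF.1.isCompact (hs.isCompact_convexHull ℝ))
    (hF.1.convex (convex_convexHull ℝ s))
  rw [(hfin.isClosed_convexHull ℝ).closure_eq] at h
  exact h.symm

/-- Split the projection of `F` to the direction of `q - p` between `p` and `q` into five equal parts:
one of them contains none of the four vertices, and an edge of `F` has to cross it. -/
theorem edist_le_longestEdge {P F : Set Space3} (hP : IsConvexPolyhedron P)
    (hF : IsQuadFacet P F) {p q : Space3} (hp : p ∈ F) (hq : q ∈ F) :
    edist q p ≤ 5 * longestEdge P F := by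
  classical
  obtain ⟨hF, hcard⟩ := hF
  rcases eq_or_ne p q with rfl | hpq
  · simp
  have hfin : (F.extremePoints ℝ).Finite := Set.finite_of_encard_eq_coe hcard
  have hFV := hF.eq_convexHull_extremePoints hP hfin
  set V := F.extremePoints ℝ with hVdef
  have hVF : V ⊆ F := extremePoints_subset
  obtain ⟨u, c, hu, hle, hFeq⟩ := hF.exists_normal hP
  have hFc : ∀ p ∈ F, inner ℝ u p = c := fun p hp => by rw [hFeq] at hp; exact hp.2
  have hu0 : u ≠ 0 := by rintro rfl; simpa using hu.1
  clear_value V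
  lift V to Finset Space3 using hfin
  rw [Set.encard_coe_eq_coe_finsetCard] at hcard
  have hcard : V.card = 4 := by exact_mod_cast hcard
  set d := q - p with hd
  have hd0 : d ≠ 0 := sub_ne_zero.2 hpq.symm
  set D := ‖d‖ with hD
  have hDpos : 0 < D := norm_pos_iff.2 hd0
  -- the normalized position of a point in the direction from `p` to `q`
  let y : Space3 → ℝ := fun v => inner ℝ d (v - p) / D ^ 2
  have hyp : y p = 0 := by simp [y]
  have hyq : y q = 1 := by
    simp only [y, ← hd, real_inner_self_eq_norm_sq, ← hD]
    exact div_self (by positivity)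
  have hyconv : ∀ {r : Space3}, r ∈ F → ∀ t : ℝ, (∀ v ∈ V, y v ≤ t) → y r ≤ t := by
    intro r hr t ht
    have := inner_le_of_mem_convexHull (s := (V : Set Space3)) (g := d) (m := t * D ^ 2 + inner ℝ d p)
      (fun v hv => by
        have := ht v hv
        simp only [y] at this
        rw [div_le_iff₀ (by positivity), inner_sub_right] at this
        linarith) r (hFV ▸ hr)
    simp only [y]
    rw [div_le_iff₀ (by positivity), inner_sub_right]
    linarith
  have hyconv' : ∀ {r : Space3}, r ∈ F → ∀ t : ℝ, (∀ v ∈ V, t ≤ y v) → t ≤ y r := by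
    intro r hr t ht
    have := inner_le_of_mem_convexHull (s := (V : Set Space3)) (g := -d)
      (m := -(t * D ^ 2 + inner ℝ d p))
      (fun v hv => by
        have := ht v hv
        simp only [y] at this
        rw [le_div_iff₀ (by positivity), inner_sub_right] at this
        rw [inner_neg_left]
        linarith) r (hFV ▸ hr)
    rw [inner_neg_left] at this
    simp only [y]
    rw [le_div_iff₀ (by positivity), inner_sub_right]
    linarith
  -- four vertices cannot meet all of the five intervals `[j / 5, (j + 1) / 5)`
  obtain ⟨j, hj, hjV⟩ : ∃ j ∈ Finset.range 5, (j : ℤ) ∉ V.image fun v => ⌊5 * y v⌋ := by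
    obtain ⟨j, hj, hj'⟩ := Finset.exists_mem_notMem_of_card_lt_card
      (s := V.image fun v => ⌊5 * y v⌋) (t := (Finset.range 5).image ((↑) : ℕ → ℤ)) (by
        rw [Finset.card_image_of_injective _ Nat.cast_injective, Finset.card_range]
        exact Finset.card_image_le.trans_lt (by omega))
    obtain ⟨i, hi, rfl⟩ := Finset.mem_image.1 hj
    exact ⟨i, hi, hj'⟩
  have hj5 : (j : ℝ) + 1 ≤ 5 := by
    have := Finset.mem_range.1 hj
    exact_mod_cast this
  have hj0 : (0 : ℝ) ≤ j := Nat.cast_nonneg j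
  have hsplit : ∀ v ∈ V, 5 * y v < j ∨ j + 1 ≤ 5 * y v := by
    intro v hv
    by_contra! h
    refine hjV (Finset.mem_image.2 ⟨v, hv, Int.floor_eq_iff.2 ?_⟩)
    exact_mod_cast h
  -- a component along `k` keeps the functional below from being constant on the plane of `F`
  obtain ⟨k, hk, hk0⟩ : ∃ k ∈ (Submodule.span ℝ {u, d})ᗮ, k ≠ 0 := by
    by_contra! h
    have h1 : (Submodule.span ℝ {u, d})ᗮ = ⊥ := (Submodule.eq_bot_iff _).2 h
    have h2 := (Submodule.span ℝ {u, d}).finrank_add_finrank_orthogonal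
    rw [h1, finrank_bot, finrank_euclideanSpace_fin] at h2
    have h3 := finrank_span_finset_le_card (R := ℝ) ({u, d} : Finset Space3)
    have h4 : ({u, d} : Finset Space3).card ≤ 2 := Finset.card_le_two
    rw [Set.finrank, Finset.coe_pair] at h3
    omega
  rw [Submodule.mem_orthogonal] at hk
  have huk : inner ℝ u k = (0 : ℝ) := hk u (Submodule.subset_span (by simp))
  have hdk : inner ℝ d k = (0 : ℝ) := hk d (Submodule.subset_span (by simp))
  have hud : inner ℝ u d = (0 : ℝ) := by rw [hd, inner_sub_right, hFc q hq, hFc p hp, sub_self]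
  -- an edge that crosses the gap between the vertices
  obtain ⟨τ, M, hM, ⟨a, ha, ha0, haM⟩, b, hb, hb0, hbM⟩ := exists_common_max V
    (fun v => 5 * y v - (j + 1 / 2)) (fun v => inner ℝ k v)
    (fun v hv => by rcases hsplit v hv with h | h <;> intro h' <;> linarith)
    (by
      by_contra! h
      have h1 : y q ≤ j / 5 := hyconv hq _ fun v hv => by
        have := h v hv
        rcases hsplit v hv with h' | h' <;> linarith
      linarith)
    (by
      by_contra! h
      have h1 : (j + 1) / 5 ≤ y p := hyconv' hp _ fun v hv => by
        have := h v hv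
        rcases hsplit v hv with h' | h' <;> linarith
      linarith)
  set w := k + (5 * τ / D ^ 2) • d with hw
  set m := M + τ * (j + 1 / 2) + 5 * τ / D ^ 2 * inner ℝ d p with hm
  have hwv : ∀ v, inner ℝ w v - m = inner ℝ k v + τ * (5 * y v - (j + 1 / 2)) - M := fun v => by
    simp only [hw, hm, y, inner_add_left, real_inner_smul_left, inner_sub_right]
    ring
  have hwF : ∀ v ∈ F, inner ℝ w v ≤ m := fun v hv =>
    inner_le_of_mem_convexHull (fun v hv => by linarith [hwv v, hM v hv]) v (hFV ▸ hv)
  have hw0 : w ≠ 0 := by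
    intro h
    have h1 : inner ℝ w k = (0 : ℝ) := by rw [h, inner_zero_left]
    rw [hw, inner_add_left, real_inner_smul_left, hdk, mul_zero, add_zero] at h1
    exact hk0 (inner_self_eq_zero.1 h1)
  have huw : inner ℝ u w = (0 : ℝ) := by
    rw [hw, inner_add_right, real_inner_smul_right, huk, hud]; ring
  have hae : a ∈ {v ∈ F | inner ℝ w v = m} := ⟨hVF ha, by linarith [hwv a]⟩
  have hbe : b ∈ {v ∈ F | inner ℝ w v = m} := ⟨hVF hb, by linarith [hwv b]⟩
  have hab : a ≠ b := by rintro rfl; linarith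
  have hedge := isEdge_setOf_inner_eq hP hu0 hle hFeq hw0 huw hwF
    (finrank_vectorSpan_pos hae hbe hab)
  have hL : edist a b ≤ longestEdge P F :=
    (Metric.edist_le_ediam_of_mem hae hbe).trans
      (le_iSup₂_of_le (f := fun (e : Set Space3) (_ : IsEdge P e ∧ e ⊆ F) => Metric.ediam e)
        _ ⟨hedge, fun v hv => hv.1⟩ le_rfl)
  refine le_trans ?_ (mul_le_mul_right hL 5)
  have hya : j + 1 ≤ 5 * y a := (hsplit a ha).resolve_left fun h => by linarith
  have hyb : 5 * y b < j := (hsplit b hb).resolve_right fun h => by linarith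
  have hreal : dist q p ≤ 5 * dist a b := by
    have h1 : D ^ 2 * (y a - y b) = inner ℝ d (a - b) := by
      simp only [y, inner_sub_right]
      field_simp
      ring
    have h2 := real_inner_le_norm d (a - b)
    rw [← h1, ← hD] at h2
    have h3 : 1 / 5 ≤ y a - y b := by linarith
    have h4 : D * (y a - y b) ≤ ‖a - b‖ := le_of_mul_le_mul_left (by linarith) hDpos
    rw [dist_eq_norm, dist_eq_norm, ← hd, ← hD]
    nlinarith
  rw [edist_dist, edist_dist, show (5 : ℝ≥0∞) = ENNReal.ofReal 5 by simp,
    ← ENNReal.ofReal_mul (by norm_num)]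
  exact ENNReal.ofReal_le_ofReal hreal

/-! ### Separation of normals -/

theorem isClosed_removeFacet (P F : Set Space3) : IsClosed (removeFacet P F) := by
  refine isClosed_iInter fun G => isClosed_iInter fun _ => ?_
  simp only [limitingHalfspace, Set.ofPred_forall]
  refine isClosed_iInter fun u => isClosed_iInter fun _ => isClosed_iInter fun y =>
    isClosed_iInter fun _ => ?_
  exact isClosed_le (by fun_prop) continuous_const

theorem convex_removeFacet (P F : Set Space3) : Convex ℝ (removeFacet P F) := by
  refine convex_iInter₂ fun G _ => ?_
  simp only [limitingHalfspace, Set.ofPred_forall]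
  refine convex_iInter₂ fun u _ => convex_iInter₂ fun y _ => ?_
  exact convex_halfSpace_le (innerSL ℝ u).isLinear _

theorem subset_removeFacet (P F : Set Space3) : P ⊆ removeFacet P F := by
  intro x hx
  refine Set.mem_iInter₂.2 fun G _ u hu y hy => ?_
  rw [hu.2] at hy
  exact hy.2 x hx

/-- The outward normal of a quadrilateral face with a good wedge of normalized height above `h` is at
distance at least `h / (h + 5)` from the outward normal of every other face. -/
theorem le_dist_normal {h : ℝ} (hh : 0 < h) {P F : Set Space3} (hP : IsConvexPolyhedron P)
    (hF : IsQuadFacet P F) (hgood : HasGoodWedge P F)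
    (hheight : ENNReal.ofReal h < normalizedWedgeHeight P F) {G : Set Space3} (hG : IsFacet P G)
    (hGF : G ≠ F) {u g : Space3} (hu : IsOutwardNormal P F u) (hg : IsOutwardNormal P G g) :
    h / (h + 5) ≤ dist u g := by
  have hfin : (F.extremePoints ℝ).Finite := Set.finite_of_encard_eq_coe hF.2
  have hFV := hF.1.eq_convexHull_extremePoints hP hfin
  obtain ⟨q, hq⟩ := nonempty_of_finrank_vectorSpan_pos (A := F) (by rw [hF.1.2]; norm_num)
  obtain ⟨y, hy⟩ := nonempty_of_finrank_vectorSpan_pos (A := G) (by rw [hG.2]; norm_num)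
  set c := inner ℝ u q with hc
  have hq' := hq
  rw [hu.2] at hq'
  have hle : ∀ p ∈ P, inner ℝ u p ≤ c := hq'.2
  have hFeq : F = {p ∈ P | inner ℝ u p = c} := by
    rw [hu.2]
    ext p
    exact and_congr_right fun hp => ⟨fun h => (hle p hp).antisymm (h q hq'.1), fun h y hy =>
      h ▸ hle y hy⟩
  have hyP : y ∈ P := by
    rw [hg.2] at hy
    exact hy.1
  -- a point `x` of the wedge, at height `H` above the plane of `F`
  have hlt := ENNReal.mul_lt_of_lt_div hheight
  obtain ⟨x, hx, hxd⟩ : ∃ x ∈ protrudingWedge P F,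
      ENNReal.ofReal h * longestEdge P F < Metric.infEDist x (affineSpan ℝ F : Set Space3) := by
    simpa only [wedgeHeight, lt_iSup_iff, exists_prop] using hlt
  have hxR : x ∈ removeFacet P F :=
    closure_minimal Set.sdiff_subset (isClosed_removeFacet P F) hx
  have hxc : c ≤ inner ℝ u x := by
    refine closure_minimal (t := {x | c ≤ inner ℝ u x}) (fun z hz => ?_)
      (isClosed_le continuous_const (by fun_prop)) hx
    by_contra hzc
    exact hz.2 (mem_of_mem_removeFacet hP hF.1 hu.1 hle hFeq hz.1 (not_le.1 hzc).le)
  set H := inner ℝ u x - c with hH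
  have hfoot := foot_mem hP hF.1 hgood hfin hFV hu hle hFeq hxR hxc
  set x' := x - H • u with hx'
  have hxx' : dist x x' = H := by
    rw [dist_eq_norm, hx', sub_sub_cancel, norm_smul, hu.1, mul_one, Real.norm_eq_abs,
      abs_of_nonneg (by linarith)]
  have hxH : ENNReal.ofReal h * longestEdge P F < ENNReal.ofReal H := by
    refine hxd.trans_le ?_
    rw [← hxx', ← edist_dist]
    exact Metric.infEDist_le_edist_of_mem (subset_affineSpan ℝ F hfoot)
  have hHpos : 0 < H := ENNReal.ofReal_pos.1 (pos_of_gt hxH)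
  -- the segment from `x` to `y` meets the plane of `F` in a point `z` of `F`
  have hyc := hle y hyP
  set t := H / (inner ℝ u x - inner ℝ u y) with ht
  have hxy : 0 < inner ℝ u x - inner ℝ u y := by linarith
  have ht0 : 0 < t := div_pos hHpos hxy
  have ht1 : t ≤ 1 := (div_le_one hxy).2 (by linarith)
  set z := x + t • (y - x) with hz
  have hzR : z ∈ removeFacet P F :=
    (convex_removeFacet P F).add_smul_sub_mem hxR (subset_removeFacet P F hyP) ⟨ht0.le, ht1⟩
  have hzc : inner ℝ u z = c := by
    rw [hz, inner_add_right, real_inner_smul_right, inner_sub_right, ht]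
    field_simp
    rw [hH]
    ring
  have hzF : z ∈ F := by
    rw [hFeq]
    exact ⟨mem_of_mem_removeFacet hP hF.1 hu.1 hle hFeq hzR hzc.le, hzc⟩
  have hgxy : inner ℝ g x ≤ inner ℝ g y := Set.mem_iInter₂.1 hxR G ⟨hG, hGF⟩ g hg y hy
  have hgxz : inner ℝ g (x - z) ≤ 0 := by
    rw [hz, sub_add_cancel_left, inner_neg_right, real_inner_smul_right, inner_sub_right]
    nlinarith
  -- `G` bounds the slope of the segment: if `g` is near `u`, the segment is nearly parallel to `F`
  have hslope : H ≤ dist u g * dist x z := by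
    have h1 : H = inner ℝ (u - g) (x - z) + inner ℝ g (x - z) := by
      rw [inner_sub_left, inner_sub_right, hzc]
      ring
    have h2 := real_inner_le_norm (u - g) (x - z)
    rw [dist_eq_norm, dist_eq_norm]
    linarith
  -- but `x'` and `z` both lie in `F`, whose diameter is small compared with `H`
  have hdiam : h * dist x' z ≤ 5 * H := by
    have h1 : ENNReal.ofReal h * edist x' z ≤ 5 * ENNReal.ofReal H := calc
      _ ≤ ENNReal.ofReal h * (5 * longestEdge P F) :=
        mul_le_mul_right (edist_le_longestEdge hP hF hzF hfoot) _
      _ = 5 * (ENNReal.ofReal h * longestEdge P F) := by ring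
      _ ≤ _ := mul_le_mul_right hxH.le _
    rw [edist_dist, ← ENNReal.ofReal_mul hh.le, show (5 : ℝ≥0∞) = ENNReal.ofReal 5 by simp,
      ← ENNReal.ofReal_mul (by norm_num)] at h1
    exact (ENNReal.ofReal_le_ofReal_iff (by linarith)).1 h1
  have htri := dist_triangle x x' z
  rw [hxx'] at htri
  rw [div_le_iff₀ (by linarith)]
  refine le_of_mul_le_mul_right ?_ hHpos
  calc h * H ≤ h * (dist u g * dist x z) := mul_le_mul_of_nonneg_left hslope hh.le
    _ = dist u g * (h * dist x z) := by ring
    _ ≤ dist u g * ((h + 5) * H) := mul_le_mul_of_nonneg_left (by nlinarith) dist_nonneg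
    _ = _ := by ring

theorem mainTheorem9 (h B : ℝ) (hh : 0 < h) :
    ∃ C : ℕ, ∀ P : Set Space3, IsConvexPolyhedron P → melzakRatio P < ENNReal.ofReal B →
      {F : Set Space3 | IsQuadFacet P F ∧ HasGoodWedge P F ∧
        ENNReal.ofReal h < normalizedWedgeHeight P F}.encard ≤ C := by
  have hδ : 0 < h / (h + 5) / 2 := by positivity
  obtain ⟨t, -, htfin, hcover⟩ :=
    (isCompact_sphere (0 : Space3) 1).finite_cover_balls hδ
  refine ⟨t.ncard, fun P hP _ => ?_⟩
  have hex : ∀ F ∈ {F : Set Space3 | IsQuadFacet P F ∧ HasGoodWedge P F ∧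
      ENNReal.ofReal h < normalizedWedgeHeight P F},
      ∃ a ∈ t, ∃ u, IsOutwardNormal P F u ∧ dist u a < h / (h + 5) / 2 := by
    intro F hF
    obtain ⟨u, c, hu, -⟩ := hF.1.1.exists_normal hP
    obtain ⟨a, ha, hua⟩ := Set.mem_iUnion₂.1 (hcover (mem_sphere_zero_iff_norm.2 hu.1))
    exact ⟨a, ha, u, hu, hua⟩
  choose! φ hφt hφ using hex
  rw [htfin.cast_ncard_eq]
  refine Set.encard_le_encard_of_injOn (f := φ) hφt fun F hF G hG hFG => ?_
  by_contra hne
  obtain ⟨u, hu, hua⟩ := hφ F hF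
  obtain ⟨g, hg, hga⟩ := hφ G hG
  have h1 := le_dist_normal hh hP hF.1 hF.2.1 hF.2.2 hG.1.1 (Ne.symm hne) hu hg
  rw [← hFG] at hga
  have h2 := dist_triangle_right u g (φ F)
  linarith
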